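/- A \emph{Bratteli diagram} $B$ consists of finite vertex sets $V_0,V_1,V_2,\dots$ with $|V_0|=1$, finite edge sets $E_1,E_2,\dots$, and surjective maps $s:E_n\to V_{n-1}$ (source) and $r:E_n\to V_n$ (range) for each $n\ge 1$. A path is a sequence of consecutive edges $e_i\in E_i$ with $r(e_i)=s(e_{i+1})$. Let $X_B$ be the set of infinite paths $x=(x_1,x_2,\dots)$, $x_i\in E_i$, starting at the top vertex, with the topology generated by the cylinder sets. The diagram $B$ is \emph{simple} if for every $n$ there is $m>n$ such that every vertex of $V_n$ is joined to every vertex of $V_m$ by a finite path. It has \emph{rank $d$} if the numbers $|V_n|$ $(n\ge1)$ are bounded and $d$ is the smallest integer such that $|V_n|=d$ for infinitely many $n$. An \emph{ordering} $\omega$ of $B$ is a choice of a linear order on each set $r^{-1}(v)$, $v\in\bigcup_{n\ge1}V_n$. A path is \emph{maximal} (\emph{minimal}) if each of its edges $e$ is maximal (minimal) in $r^{-1}(r(e))$; $X_{\max}(\omega)$ and $X_{\min}(\omega)$ denote the sets of maximal and minimal infinite paths in $X_B$. A \emph{Vershik map} of $(B,\omega)$ is a homeomorphism $\varphi:X_B\to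 X_B$ such that $\varphi(X_{\max}(\omega))=X_{\min}(\omega)$ and, for every $x\notin X_{\max}(\omega)$, with $k$ the least index for which $x_k$ is not maximal, $$\varphi(x)=(x^0_1,\dots,x^0_{k-1},\overline{x_k},x_{k+1},x_{k+2},\dots),$$ where $\overline{x_k}$ is the successor of $x_k$ in $r^{-1}(r(x_k))$ and $(x_1^0,\dots,x_{k-1}^0)$ is the minimal path from the top vertex to $s(\overline{x_k})$. The ordering $\omega$ is \emph{perfect} if it admits a Vershik map. A \emph{Cantor set} is a nonempty compact metrizable totally disconnected space without isolated points. Two homeomorphisms $S:X\to X$ and $T:Y\to Y$ are \emph{topologically conjugate} if $h\circ S=T\circ h$ for some homeomorphism $h:X\to Y$. An \emph{odometer} is a homeomorphism $T$ of a Cantor set $Y$ all of whose orbits $\{T^k y:k\in\mathbb Z\}$ are dense and which is topologically conjugate to a Vershik map of some ordered Bratteli diagram with exactly one vertex at every level. \textbf{Statement.} Let $B$ be a simple Bratteli diagram of rank $d\ge 2$ and let $\omega$ be a perfect ordering of $B$ with exactly $d$ maximal infinite paths, $|X_{\max}(\omega)|=d$. Then for every Vershik map $\varphi_\omega$ of $(B,\omega)$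 the system $(X_B,\varphi_\omega)$ is topologically conjugate to an odometer. -/

import Mathlib

universe u

/-- A Bratteli diagram. `V n` is the `n`-th level of vertices, and `E n` is the set of edges
between the levels `n` and `n + 1`, each going from its source `s e` to its range `r e`. -/
structure BratteliDiagram where
  V : ℕ → Type u
  E : ℕ → Type u
  s : ∀ {n : ℕ}, E n → V n
  r : ∀ {n : ℕ}, E n → V (n + 1)
  finite_V : ∀ n, Finite (V n)
  finite_E : ∀ n, Finite (E n)
  card_V_zero : Nat.card (V 0) = 1
  s_surjective : ∀ n, Function.Surjective (s : E n → V n)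
  r_surjective : ∀ n, Function.Surjective (r : E n → V (n + 1))

namespace BratteliDiagram

/-- `B.FinitePath v w` is the set `E(v, w)` of finite paths, with at least one edge,
from the vertex `v` down to the vertex `w`. -/
inductive FinitePath (B : BratteliDiagram.{u}) : {m n : ℕ} → B.V m → B.V n → Type u
  | single {n : ℕ} {v : B.V n} {w : B.V (n + 1)} (e : B.E n)
      (hs : B.s e = v) (hr : B.r e = w) : FinitePath B v w
  | snoc {m n : ℕ} {v : B.V m} {w : B.V n} {w' : B.V (n + 1)} (p : FinitePath B v w) (e : B.E n)
      (hs : B.s e = w) (hr : B.r e = w') : FinitePath B v w'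

/-- From every level `n` there is a later level `m` such that every vertex of level `n` is joined
by a path to every vertex of level `m`. -/
def IsSimple (B : BratteliDiagram.{u}) : Prop :=
  ∀ n : ℕ, ∃ m : ℕ, n < m ∧ ∀ (v : B.V n) (w : B.V m), Nonempty (B.FinitePath v w)

/-- The numbers of vertices of the levels `n ≥ 1` are bounded. -/
def IsFiniteRank (B : BratteliDiagram.{u}) : Prop :=
  ∃ k : ℕ, ∀ n : ℕ, 1 ≤ n → Nat.card (B.V n) ≤ k

/-- `B` has finite rank, and `d` is the least integer such that `|V n| = d` for infinitely
many `n`. -/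
def HasRank (B : BratteliDiagram.{u}) (d : ℕ) : Prop :=
  B.IsFiniteRank ∧ IsLeast {j : ℕ | {n : ℕ | Nat.card (B.V n) = j}.Infinite} d

/-- The infinite paths that start at the top vertex. -/
def PathSpace (B : BratteliDiagram.{u}) : Type u :=
  {x : ∀ n : ℕ, B.E n // ∀ n : ℕ, B.r (x n) = B.s (x (n + 1))}

instance (B : BratteliDiagram.{u}) (n : ℕ) : TopologicalSpace (B.E n) := ⊥

instance (B : BratteliDiagram.{u}) (n : ℕ) : DiscreteTopology (B.E n) := ⟨rfl⟩

/-- The topology generated by the cylinder sets, that is, the topology induced by the product of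
the discrete topologies on the sets of edges. -/
instance (B : BratteliDiagram.{u}) : TopologicalSpace B.PathSpace :=
  inferInstanceAs
    (TopologicalSpace {x : ∀ n : ℕ, B.E n // ∀ n : ℕ, B.r (x n) = B.s (x (n + 1))})

/-- An ordering of `B`: a (strict) linear order on each set `r⁻¹(v)`, given as a partial order on
the edges in which two edges are comparable only if they have the same range. -/
structure EdgeOrder (B : BratteliDiagram.{u}) where
  lt : ∀ {n : ℕ}, B.E n → B.E n → Prop
  range_eq : ∀ {n : ℕ} {e f : B.E n}, lt e f → B.r e = B.r f
  irrefl : ∀ {n : ℕ} (e : B.E n), ¬ lt e e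
  trans : ∀ {n : ℕ} {e f g : B.E n}, lt e f → lt f g → lt e g
  trichotomous : ∀ {n : ℕ} {e f : B.E n}, B.r e = B.r f → lt e f ∨ e = f ∨ lt f e

namespace EdgeOrder

variable {B : BratteliDiagram.{u}}

/-- `e` is maximal in `r⁻¹(r(e))`. -/
def IsMaxEdge (ω : B.EdgeOrder) {n : ℕ} (e : B.E n) : Prop := ∀ f : B.E n, ¬ ω.lt e f

/-- `e` is minimal in `r⁻¹(r(e))`. -/
def IsMinEdge (ω : B.EdgeOrder) {n : ℕ} (e : B.E n) : Prop := ∀ f : B.E n, ¬ ω.lt f e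

/-- `f` is the successor of `e` in `r⁻¹(r(e))`. -/
def IsSuccEdge (ω : B.EdgeOrder) {n : ℕ} (e f : B.E n) : Prop :=
  ω.lt e f ∧ ∀ g : B.E n, ω.lt e g → ¬ ω.lt g f

/-- The set of maximal infinite paths. -/
def maxPaths (ω : B.EdgeOrder) : Set B.PathSpace := {x | ∀ n, ω.IsMaxEdge (x.1 n)}

/-- The set of minimal infinite paths. -/
def minPaths (ω : B.EdgeOrder) : Set B.PathSpace := {x | ∀ n, ω.IsMinEdge (x.1 n)}

/-- The homeomorphism `φ` is a Vershik map: it maps the set of maximal paths onto the set of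
minimal paths, and if `x k` is the first edge of the path `x` that is not maximal, then `φ x` is
obtained from `x` by replacing `x k` by its successor, leaving the later edges unchanged, and
taking as initial segment the minimal finite path that ends at the source of this successor. -/
structure IsVershikMap (ω : B.EdgeOrder) (φ : B.PathSpace ≃ₜ B.PathSpace) : Prop where
  image_maxPaths : φ '' ω.maxPaths = ω.minPaths
  succ : ∀ (x : B.PathSpace) (k : ℕ), (∀ i < k, ω.IsMaxEdge (x.1 i)) → ¬ ω.IsMaxEdge (x.1 k) →
    (∀ i < k, ω.IsMinEdge ((φ x).1 i)) ∧ ω.IsSuccEdge (x.1 k) ((φ x).1 k) ∧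
      ∀ i, k < i → (φ x).1 i = x.1 i

/-- An ordering is perfect if it admits a Vershik map. -/
def IsPerfect (ω : B.EdgeOrder) : Prop := ∃ φ : B.PathSpace ≃ₜ B.PathSpace, ω.IsVershikMap φ

end EdgeOrder

/-- Topological conjugacy of two dynamical systems. -/
def IsTopConjugate {X Y : Type*} [TopologicalSpace X] [TopologicalSpace Y]
    (S : X ≃ₜ X) (T : Y ≃ₜ Y) : Prop :=
  ∃ h : X ≃ₜ Y, ∀ x : X, h (S x) = T (h x)

/-- `Y` is a Cantor set: a nonempty compact metrizable totally disconnected space without isolated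
points. -/
structure IsCantorSpace (Y : Type*) [TopologicalSpace Y] : Prop where
  nonempty : Nonempty Y
  compact : CompactSpace Y
  metrizable : TopologicalSpace.MetrizableSpace Y
  totallyDisconnected : TotallyDisconnectedSpace Y
  perfect : PerfectSpace Y

/-- Every orbit of `T` is dense. -/
def IsMinimalSystem {Y : Type*} [TopologicalSpace Y] (T : Y ≃ₜ Y) : Prop :=
  ∀ y : Y, Dense (Set.range fun k : ℤ => (T ^ k) y)

/-- An odometer: a minimal Cantor system that is conjugate to the Vershik map of an ordered
Bratteli diagram with exactly one vertex at every level. -/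
structure IsOdometer {Y : Type*} [TopologicalSpace Y] (T : Y ≃ₜ Y) : Prop where
  cantor : IsCantorSpace Y
  minimal : IsMinimalSystem T
  adic : ∃ (B : BratteliDiagram.{0}) (ω : B.EdgeOrder) (ψ : B.PathSpace ≃ₜ B.PathSpace),
    (∀ n, Nat.card (B.V n) = 1) ∧ ω.IsVershikMap ψ ∧ IsTopConjugate T ψ

end BratteliDiagram

/-! Since a Vershik map `φ` is a bijection taking maximal paths to minimal ones, there are exactly
`d` minimal paths. Beyond some level they have distinct prefixes, and a vertex is the end of only
one minimal path from the top. So at a late level `m` with `d` vertices, each vertex lies on exactly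
one infinite minimal path, and each minimal prefix of length `m` extends to exactly one of these.

Hence `φ` permutes the cylinders of length `m` (`exists_forall_agree`). If a prefix has a
non-maximal edge, its image prefix is determined by the successor rule. If it is maximal, its image
prefix is minimal, and by uniform continuity the first `n` image edges, which already single out one
minimal path, depend only on the prefix.

Simplicity makes this permutation transitive, so the cylinders form a cyclic factor `ℤ/H`
(`exists_residue`). Infinitely many such levels give compatible factors separating points
(`exists_cyclicCoding`). Mixed radix digits then turn `φ` into addition of one with carry, the
Vershik map of a one-vertex diagram (`isVershikMap_adicMap`). -/

namespace BratteliDiagram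

/-! ### Gluing and uniqueness of paths -/

section Paths

variable {B : BratteliDiagram.{u}}

/-- The paths `x` and `y` have the same first `m` edges. -/
def Agree (m : ℕ) (x y : B.PathSpace) : Prop := ∀ i < m, x.1 i = y.1 i

theorem Agree.symm {m : ℕ} {x y : B.PathSpace} (h : Agree m x y) : Agree m y x :=
  fun i hi => (h i hi).symm

theorem Agree.trans {m : ℕ} {x y z : B.PathSpace} (h : Agree m x y) (h' : Agree m y z) :
    Agree m x z :=
  fun i hi => (h i hi).trans (h' i hi)

theorem Agree.mono {m n : ℕ} (hmn : m ≤ n) {x y : B.PathSpace} (h : Agree n x y) : Agree m x y :=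
  fun i hi => h i (hi.trans_le hmn)

/-- The prefix is chosen upwards from level `N`, one edge at a time. The values of `t` below `N` are
irrelevant. -/
theorem exists_path_of_tail (P : ∀ n, B.E n → Prop)
    (hP : ∀ n (v : B.V (n + 1)), ∃ e : B.E n, B.r e = v ∧ P n e) (N : ℕ) :
    ∀ t : ∀ i, B.E i, (∀ i, N ≤ i → B.r (t i) = B.s (t (i + 1))) →
      ∃ x : B.PathSpace, (∀ i < N, P i (x.1 i)) ∧ ∀ i, N ≤ i → x.1 i = t i := by
  induction N with
  | zero => exact fun t ht => ⟨⟨t, fun n => ht n n.zero_le⟩, by simp, fun i _ => rfl⟩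
  | succ N ih =>
    intro t ht
    obtain ⟨e, he, hPe⟩ := hP N (B.s (t (N + 1)))
    obtain ⟨x, hx, hxt⟩ := ih (Function.update t N e) (by
      intro i hi
      rcases hi.eq_or_lt with rfl | hi
      · simp [he]
      · rw [Function.update_of_ne hi.ne', Function.update_of_ne (by omega)]
        exact ht i hi)
    refine ⟨x, fun i hi => ?_, fun i hi => ?_⟩
    · rcases (Nat.lt_succ_iff.1 hi).eq_or_lt with rfl | hi
      · rw [hxt i le_rfl, Function.update_self]; exact hPe
      · exact hx i hi
    · rw [hxt i (by omega), Function.update_of_ne (by omega)]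

theorem nonempty_edge (B : BratteliDiagram.{u}) (n : ℕ) : Nonempty (B.E n) := by
  induction n with
  | zero =>
    have : Nonempty (B.V 0) := by
      by_contra h
      rw [not_nonempty_iff] at h
      have := B.card_V_zero
      simp at this
    exact this.elim fun v => ⟨(B.s_surjective 0 v).choose⟩
  | succ n ih => exact ih.elim fun e => ⟨(B.s_surjective (n + 1) (B.r e)).choose⟩

theorem exists_path_through {n : ℕ} (e : B.E n) : ∃ x : B.PathSpace, x.1 n = e := by
  choose g hg using fun (i : ℕ) (e : B.E i) => B.s_surjective (i + 1) (B.r e)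
  -- Below `n` the entries are placeholders; from `n` on, `e` is continued downwards by choosing
  -- edges with the right source.
  let t : ∀ i, B.E i := fun i =>
    if h : n ≤ i then Nat.leRec (motive := fun i _ => B.E i) e (fun i _ e => g i e) h
    else (B.nonempty_edge i).some
  obtain ⟨x, -, hx⟩ := exists_path_of_tail (fun _ _ => True)
    (fun n v => (B.r_surjective n v).imp fun _ h => ⟨h, trivial⟩) n t (by
      intro i hi
      have h1 : n ≤ i + 1 := by omega
      simp only [t, hi, h1, dif_pos]
      rw [Nat.leRec_succ (motive := fun i _ => B.E i) e (fun i _ e => g i e) hi, hg])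
  exact ⟨x, by rw [hx n le_rfl]; simp [t]⟩

instance : Nonempty B.PathSpace :=
  (B.nonempty_edge 0).elim fun e => ⟨(exists_path_through e).choose⟩

/-- Follow `x` down to level `n` and then `y`. -/
theorem exists_splice (n : ℕ) (x y : B.PathSpace) (h : B.s (x.1 n) = B.s (y.1 n)) :
    ∃ z : B.PathSpace, Agree n z x ∧ ∀ i, n ≤ i → z.1 i = y.1 i := by
  refine ⟨⟨fun i => if i < n then x.1 i else y.1 i, fun i => ?_⟩, ?_, ?_⟩
  · by_cases h1 : i + 1 < n
    · simp [h1, (Nat.lt_succ_self i).trans h1, x.2]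
    · by_cases h2 : i < n
      · obtain rfl : n = i + 1 := by omega
        simp [x.2, h]
      · simp [h1, h2, y.2]
  · intro i hi; simp [hi]
  · intro i hi; simp [hi.not_gt]

theorem FinitePath.exists_path {m n : ℕ} {v : B.V m} {w : B.V n} (p : B.FinitePath v w) :
    m < n ∧ ∀ x : B.PathSpace, B.s (x.1 m) = v →
      ∃ z : B.PathSpace, Agree m z x ∧ B.s (z.1 n) = w := by
  induction p with
  | single e hs hr =>
    refine ⟨Nat.lt_succ_self _, fun x hx => ?_⟩
    obtain ⟨y, rfl⟩ := exists_path_through e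
    obtain ⟨z, hz, hzy⟩ := exists_splice _ x y (hx.trans hs.symm)
    exact ⟨z, hz, by rw [hzy _ (Nat.le_succ _), ← y.2, hr]⟩
  | snoc p e hs hr ih =>
    refine ⟨ih.1.trans (Nat.lt_succ_self _), fun x hx => ?_⟩
    obtain ⟨x', hx', hx's⟩ := ih.2 x hx
    obtain ⟨y, rfl⟩ := exists_path_through e
    obtain ⟨z, hz, hzy⟩ := exists_splice _ x' y (hx's.trans hs.symm)
    exact ⟨z, (hz.mono ih.1.le).trans hx', by rw [hzy _ (Nat.le_succ _), ← y.2, hr]⟩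

/-- Each edge is determined by its range, so the whole prefix can be read upwards from its final
vertex. The case needed is that of minimal edges. -/
theorem agree_of_unique (P : ∀ n, B.E n → Prop)
    (hP : ∀ n (e f : B.E n), P n e → P n f → B.r e = B.r f → e = f) (m : ℕ) :
    ∀ x y : B.PathSpace, (∀ i < m, P i (x.1 i)) → (∀ i < m, P i (y.1 i)) →
      B.s (x.1 m) = B.s (y.1 m) → Agree m x y := by
  induction m with
  | zero => intro x y _ _ _ i hi; omega
  | succ m ih =>
    intro x y hx hy h
    rw [← x.2, ← y.2] at h
    have hm := hP m _ _ (hx m m.lt_succ_self) (hy m m.lt_succ_self) h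
    intro i hi
    rcases (Nat.lt_succ_iff.1 hi).eq_or_lt with rfl | hi
    · exact hm
    · exact ih x y (fun i hi => hx i (by omega)) (fun i hi => hy i (by omega)) (by rw [hm]) i hi

end Paths

/-! ### Topology of the path space -/

section Topology

variable {B : BratteliDiagram.{u}}

instance (n : ℕ) : Finite (B.E n) := B.finite_E n

instance (n : ℕ) : Finite (B.V n) := B.finite_V n

theorem isClosed_paths (B : BratteliDiagram.{u}) :
    IsClosed {x : ∀ n : ℕ, B.E n | ∀ n : ℕ, B.r (x n) = B.s (x (n + 1))} := by
  rw [Set.ofPred_forall]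
  refine isClosed_iInter fun n => ?_
  have h1 : IsClosed {p : B.E n × B.E (n + 1) | B.r p.1 = B.s p.2} := isClosed_discrete _
  exact h1.preimage (f := fun x : ∀ n : ℕ, B.E n => (x n, x (n + 1))) (by fun_prop)

instance : CompactSpace B.PathSpace :=
  isCompact_iff_compactSpace.1 B.isClosed_paths.isCompact

instance : T2Space B.PathSpace :=
  inferInstanceAs (T2Space {x : ∀ n : ℕ, B.E n // ∀ n : ℕ, B.r (x n) = B.s (x (n + 1))})

instance : SecondCountableTopology B.PathSpace :=
  have (n : ℕ) : SecondCountableTopology (B.E n) := inferInstance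
  TopologicalSpace.Subtype.secondCountableTopology _

instance : TopologicalSpace.MetrizableSpace B.PathSpace :=
  TopologicalSpace.metrizableSpace_of_t3_secondCountable _

instance : TotallyDisconnectedSpace B.PathSpace :=
  inferInstanceAs (TotallyDisconnectedSpace
    {x : ∀ n : ℕ, B.E n // ∀ n : ℕ, B.r (x n) = B.s (x (n + 1))})

theorem continuous_edge (n : ℕ) : Continuous fun x : B.PathSpace => x.1 n :=
  (continuous_apply n).comp continuous_subtype_val

theorem isOpen_agree (m : ℕ) (x : B.PathSpace) : IsOpen {y | Agree m y x} := by
  have : {y : B.PathSpace | Agree m y x} =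
      ⋂ i ∈ Set.Iio m, (fun y : B.PathSpace => y.1 i) ⁻¹' {x.1 i} := by
    ext y; simp [Agree]
  rw [this]
  exact (Set.finite_Iio m).isOpen_biInter fun i _ =>
    (isOpen_discrete _).preimage (continuous_edge i)

theorem exists_agree_subset {U : Set B.PathSpace} (hU : IsOpen U) {x : B.PathSpace} (hx : x ∈ U) :
    ∃ m, ∀ y, Agree m y x → y ∈ U := by
  obtain ⟨W, hW, rfl⟩ := isOpen_induced_iff.1 hU
  obtain ⟨_, ⟨z, m, rfl⟩, hxz, hsub⟩ :=
    (PiNat.isTopologicalBasis_cylinders B.E).exists_subset_of_mem_open (a := x.1) hx hW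
  refine ⟨m, fun y hy => hsub fun i hi => ?_⟩
  exact (hy i hi).trans (hxz i hi)

/-- Uniform continuity on a compact space, in terms of cylinders. -/
theorem exists_agree_map (f : C(B.PathSpace, B.PathSpace)) (n : ℕ) :
    ∃ m, ∀ x y, Agree m x y → Agree n (f x) (f y) := by
  choose m hm using fun x => exists_agree_subset ((isOpen_agree n (f x)).preimage f.continuous)
    (x := x) (fun _ _ => rfl)
  obtain ⟨t, ht⟩ := isCompact_univ.elim_finite_subcover (fun x => {y | Agree (m x) y x})
    (fun x => isOpen_agree _ x) (fun x _ => Set.mem_iUnion.2 ⟨x, fun _ _ => rfl⟩)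
  refine ⟨t.sup m, fun x y hxy => ?_⟩
  obtain ⟨z, hz, hxz⟩ := Set.mem_iUnion₂.1 (ht (Set.mem_univ x))
  have h1 : Agree n (f x) (f z) := hm z x hxz
  have h2 : Agree n (f y) (f z) :=
    hm z y ((hxy.mono (Finset.le_sup hz)).symm.trans hxz)
  exact h1.trans h2.symm

theorem exists_agree_separates {S : Set B.PathSpace} (hS : S.Finite) :
    ∃ n, ∀ x ∈ S, ∀ y ∈ S, Agree n x y → x = y := by
  have h : ∀ p : B.PathSpace × B.PathSpace, ∃ i, p.1 ≠ p.2 → p.1.1 i ≠ p.2.1 i := by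
    intro p
    by_cases hp : p.1 = p.2
    · exact ⟨0, fun h => (h hp).elim⟩
    · by_contra! h
      exact hp (Subtype.ext (funext fun i => (h i).2))
  choose g hg using h
  obtain ⟨n, hn⟩ := ((hS.prod hS).image g).bddAbove
  refine ⟨n + 1, fun x hx y hy hxy => ?_⟩
  by_contra hne
  exact hg (x, y) hne (hxy _ (Nat.lt_succ_of_le (hn ⟨(x, y), ⟨hx, hy⟩, rfl⟩)))

end Topology

/-! ### Dynamics of Vershik maps on cylinders and orbits -/

namespace EdgeOrder

variable {B : BratteliDiagram.{u}} (ω : B.EdgeOrder)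

theorem wellFounded_gt (n : ℕ) : WellFounded (fun e f : B.E n => ω.lt f e) := by
  have : IsTrans (B.E n) (fun e f => ω.lt f e) := ⟨fun _ _ _ h h' => ω.trans h' h⟩
  have : Std.Irrefl (fun e f : B.E n => ω.lt f e) := ⟨ω.irrefl⟩
  exact Finite.wellFounded_of_trans_of_irrefl _

theorem exists_isMaxEdge (n : ℕ) (v : B.V (n + 1)) :
    ∃ e : B.E n, B.r e = v ∧ ω.IsMaxEdge e := by
  obtain ⟨e, he, h⟩ := (ω.wellFounded_gt n).has_min {e | B.r e = v} (B.r_surjective n v)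
  exact ⟨e, he, fun f hf => h f ((ω.range_eq hf).symm.trans he) hf⟩

variable {ω}

theorem IsMinEdge.eq {n : ℕ} {e f : B.E n} (he : ω.IsMinEdge e) (hf : ω.IsMinEdge f)
    (h : B.r e = B.r f) : e = f := by
  rcases ω.trichotomous h with h | h | h
  · exact (hf _ h).elim
  · exact h
  · exact (he _ h).elim

theorem IsSuccEdge.eq {n : ℕ} {e f g : B.E n} (hf : ω.IsSuccEdge e f) (hg : ω.IsSuccEdge e g) :
    f = g := by
  rcases ω.trichotomous ((ω.range_eq hf.1).symm.trans (ω.range_eq hg.1)) with h | h | h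
  · exact (hg.2 _ hf.1 h).elim
  · exact h
  · exact (hf.2 _ hg.1 h).elim

namespace IsVershikMap

variable {φ : B.PathSpace ≃ₜ B.PathSpace} (hφ : ω.IsVershikMap φ)
include hφ

theorem isMinEdge_of_isMaxEdge {m : ℕ} {x : B.PathSpace} (hx : ∀ i < m, ω.IsMaxEdge (x.1 i)) :
    ∀ i < m, ω.IsMinEdge ((φ x).1 i) := by
  classical
  by_cases h : ∃ k, ¬ ω.IsMaxEdge (x.1 k)
  · have hk := Nat.find_spec h
    have hlt : ∀ i < Nat.find h, ω.IsMaxEdge (x.1 i) := fun i hi => not_not.1 (Nat.find_min h hi)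
    have hm : m ≤ Nat.find h := by
      by_contra hm
      exact hk (hx _ (not_le.1 hm))
    exact fun i hi => (hφ.succ x _ hlt hk).1 i (hi.trans_le hm)
  · push Not at h
    have : φ x ∈ ω.minPaths := hφ.image_maxPaths ▸ Set.mem_image_of_mem φ h
    exact fun i _ => this i

theorem agree_of_not_isMaxEdge {m k : ℕ} {x y : B.PathSpace} (h : Agree m x y) (hkm : k < m)
    (hlt : ∀ i < k, ω.IsMaxEdge (x.1 i)) (hk : ¬ ω.IsMaxEdge (x.1 k)) :
    Agree m (φ x) (φ y) := by
  obtain ⟨hx1, hx2, hx3⟩ := hφ.succ x k hlt hk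
  obtain ⟨hy1, hy2, hy3⟩ := hφ.succ y k (fun i hi => h i (hi.trans hkm) ▸ hlt i hi)
    (h k hkm ▸ hk)
  have heq : (φ x).1 k = (φ y).1 k := hx2.eq (by rw [h k hkm]; exact hy2)
  intro i hi
  rcases lt_trichotomy i k with hik | rfl | hik
  · exact agree_of_unique (fun _ e => ω.IsMinEdge e) (fun _ _ _ => IsMinEdge.eq) k _ _ hx1 hy1
      (by rw [heq]) i hik
  · exact heq
  · rw [hx3 i hik, hy3 i hik, h i hi]

/-- If there are as many minimal paths as vertices at level `m`, then for large `m` the Vershik map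
permutes the cylinders of length `m`. -/
theorem exists_forall_agree (hfin : ω.minPaths.Finite) :
    ∃ N, ∀ m ≥ N, Nat.card (B.V m) = ω.minPaths.ncard →
      ∀ x y, Agree m x y → Agree m (φ x) (φ y) := by
  classical
  obtain ⟨n, hn⟩ := exists_agree_separates hfin
  obtain ⟨N, hN⟩ := exists_agree_map (φ : C(B.PathSpace, B.PathSpace)) n
  refine ⟨max n N, fun m hm hcard x y hxy => ?_⟩
  -- A non-maximal edge before level `m` makes the successor rule local; otherwise the common prefix
  -- is maximal.
  by_cases h : ∃ k, k < m ∧ ¬ ω.IsMaxEdge (x.1 k)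
  · obtain ⟨hk, hk'⟩ := Nat.find_spec h
    refine hφ.agree_of_not_isMaxEdge hxy hk (fun i hi => ?_) hk'
    by_contra hi'
    exact Nat.find_min h hi ⟨hi.trans hk, hi'⟩
  · push Not at h
    -- Minimal paths meeting at a vertex of level `m` agree up to `m ≥ n`, hence coincide; equal
    -- cardinalities turn this injectivity into surjectivity.
    have hsurj : ∀ v : B.V m, ∃ μ ∈ ω.minPaths, B.s (μ.1 m) = v := by
      have := hfin.to_subtype
      have hinj : Function.Injective (fun μ : ω.minPaths => B.s (μ.1.1 m)) := by
        intro μ ν h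
        refine Subtype.ext (hn _ μ.2 _ ν.2 (Agree.mono (le_of_max_le_left hm) ?_))
        exact agree_of_unique (fun _ e => ω.IsMinEdge e) (fun _ _ _ => IsMinEdge.eq) m _ _
          (fun i _ => μ.2 i) (fun i _ => ν.2 i) h
      have hbij := hinj.bijective_of_nat_card_le (by rw [hcard, _root_.Nat.card_coe_set_eq])
      intro v
      obtain ⟨μ, hμ⟩ := hbij.2 v
      exact ⟨μ, μ.2, hμ⟩
    have key : ∀ z : B.PathSpace, (∀ i < m, ω.IsMinEdge (z.1 i)) →
        ∃ μ ∈ ω.minPaths, Agree m z μ := by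
      intro z hz
      obtain ⟨μ, hμ, hs⟩ := hsurj (B.s (z.1 m))
      exact ⟨μ, hμ, agree_of_unique (fun _ e => ω.IsMinEdge e) (fun _ _ _ => IsMinEdge.eq) m _ _
        hz (fun i _ => hμ i) hs.symm⟩
    obtain ⟨μ, hμ, hxμ⟩ := key _ (hφ.isMinEdge_of_isMaxEdge h)
    obtain ⟨ν, hν, hyν⟩ := key _
      (hφ.isMinEdge_of_isMaxEdge (x := y) (fun i hi => hxy i hi ▸ h i hi))
    have hnm : n ≤ m := le_of_max_le_left hm
    have hφxy : Agree n (φ x) (φ y) := hN x y (hxy.mono (le_of_max_le_right hm))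
    obtain rfl : μ = ν := hn _ hμ _ hν
      ((hxμ.mono hnm).symm.trans (hφxy.trans (hyν.mono hnm)))
    exact hxμ.trans hyν.symm

/-- Cofinal paths lie in one orbit. The induction hypothesis moves freely among prefixes above a
fixed tail, in particular to the maximal prefix, from which `φ` advances the edge at `N`. -/
theorem exists_zpow_eq_of_tail (N : ℕ) :
    ∀ x y : B.PathSpace, (∀ i, N ≤ i → x.1 i = y.1 i) → ∃ k : ℤ, (φ ^ k) x = y := by
  induction N with
  | zero =>
    intro x y h
    exact ⟨0, Subtype.ext (funext fun i => h i i.zero_le)⟩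
  | succ N ih =>
    -- Well-founded induction on the edge of `x` at `N`, climbing by successors until it reaches
    -- `f`.
    have up : ∀ f : B.E N, ∀ x y : B.PathSpace, y.1 N = f →
        (∀ i, N + 1 ≤ i → x.1 i = y.1 i) → ω.lt (x.1 N) f → ∃ k : ℤ, (φ ^ k) x = y := by
      intro f x
      have hx : ∃ e, x.1 N = e := ⟨_, rfl⟩
      obtain ⟨e, he⟩ := hx
      induction e using (ω.wellFounded_gt N).induction generalizing x with
      | _ e ihe =>
      intro y hyf hxy hlt
      obtain ⟨z, hzmax, hzx⟩ := exists_path_of_tail (fun _ e => ω.IsMaxEdge e)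
        ω.exists_isMaxEdge N x.1 (fun i _ => x.2 i)
      obtain ⟨k, hk⟩ := ih x z (fun i hi => (hzx i hi).symm)
      obtain ⟨-, hs, ht⟩ := hφ.succ z N hzmax (by
        rw [hzx N le_rfl]
        exact fun h => h _ hlt)
      have hstep : (φ ^ (k + 1)) x = φ z := by
        rw [add_comm, zpow_add, zpow_one, Homeomorph.mul_apply, hk]
      have htail : ∀ i, N + 1 ≤ i → (φ z).1 i = y.1 i := fun i hi => by
        rw [ht i hi, hzx i (by omega), hxy i hi]
      rw [hzx N le_rfl] at hs
      have hcmp : ω.lt ((φ z).1 N) f ∨ (φ z).1 N = f ∨ ω.lt f ((φ z).1 N) :=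
        ω.trichotomous ((ω.range_eq hs.1).symm.trans (ω.range_eq hlt))
      obtain ⟨l, hl⟩ : ∃ l : ℤ, (φ ^ l) (φ z) = y := by
        rcases hcmp with h | h | h
        · exact ihe _ (he ▸ hs.1) (φ z) rfl y hyf htail h
        · refine ih _ _ fun i hi => ?_
          rcases hi.eq_or_lt with rfl | hi
          · rw [h, hyf]
          · exact htail i hi
        · exact (hs.2 f hlt h).elim
      exact ⟨l + (k + 1), by rw [zpow_add, Homeomorph.mul_apply, hstep, hl]⟩
    intro x y h
    have hr : B.r (x.1 N) = B.r (y.1 N) := by rw [x.2, y.2, h _ le_rfl]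
    rcases ω.trichotomous hr with hlt | heq | hlt
    · exact up _ x y rfl h hlt
    · refine ih x y fun i hi => ?_
      rcases hi.eq_or_lt with rfl | hi
      · exact heq
      · exact h i hi
    · obtain ⟨k, hk⟩ := up _ y x rfl (fun i hi => (h i hi).symm) hlt
      exact ⟨-k, by rw [← hk, ← Homeomorph.mul_apply, ← zpow_add]; simp⟩

/-- By simplicity the prefix of `y` can be joined to a tail of `x`; the resulting path is cofinal
with `x`. -/
theorem exists_zpow_agree (hB : B.IsSimple) (m : ℕ) (x y : B.PathSpace) :
    ∃ k : ℤ, Agree m ((φ ^ k) x) y := by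
  obtain ⟨n, hmn, hn⟩ := hB m
  obtain ⟨p⟩ := hn (B.s (y.1 m)) (B.s (x.1 n))
  obtain ⟨y', hy', hs⟩ := p.exists_path.2 y rfl
  obtain ⟨z, hz, hzx⟩ := exists_splice n y' x hs
  obtain ⟨k, hk⟩ := hφ.exists_zpow_eq_of_tail n x z (fun i hi => (hzx i hi).symm)
  exact ⟨k, hk ▸ (hz.mono hmn.le).trans hy'⟩

theorem isMinimalSystem (hB : B.IsSimple) : IsMinimalSystem φ := by
  intro x
  rw [dense_iff_inter_open]
  rintro U hU ⟨y, hy⟩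
  obtain ⟨m, hm⟩ := exists_agree_subset hU hy
  obtain ⟨k, hk⟩ := hφ.exists_zpow_agree hB m x y
  exact ⟨_, hm _ hk, k, rfl⟩

end IsVershikMap

end EdgeOrder

/-! ### Absence of isolated points -/

theorem perfectSpace_pathSpace {B : BratteliDiagram.{u}} (hB : B.IsSimple) {N₀ : ℕ}
    (h : ∀ n ≥ N₀, 2 ≤ Nat.card (B.V n)) : PerfectSpace B.PathSpace := by
  refine perfectSpace_iff_forall_not_isolated.2 fun x => ?_
  rw [← mem_closure_iff_nhdsWithin_neBot, mem_closure_iff]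
  intro U hU hx
  obtain ⟨k, hk⟩ := exists_agree_subset hU hx
  obtain ⟨n, hn, hpath⟩ := hB (max k N₀)
  have : Nontrivial (B.V n) :=
    Finite.one_lt_card_iff_nontrivial.1 (h n ((le_max_right _ _).trans hn.le))
  obtain ⟨v, hv⟩ := exists_ne (B.s (x.1 n))
  obtain ⟨p⟩ := hpath (B.s (x.1 (max k N₀))) v
  obtain ⟨z, hz, hs⟩ := p.exists_path.2 x rfl
  refine ⟨z, hk z (hz.mono (le_max_left _ _)), ?_⟩
  rintro rfl
  exact hv hs.symm

theorem HasRank.two_le_card {B : BratteliDiagram.{u}} {d : ℕ} (h : B.HasRank d) (hd : 2 ≤ d) :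
    ∃ N, ∀ n ≥ N, 2 ≤ Nat.card (B.V n) := by
  have hfin : ∀ j < d, {n : ℕ | Nat.card (B.V n) = j}.Finite := fun j hj => by
    by_contra hinf
    exact (h.2.2 hinf).not_gt hj
  obtain ⟨N, hN⟩ := ((hfin 0 (by omega)).union (hfin 1 (by omega))).bddAbove
  refine ⟨N + 1, fun n hn => ?_⟩
  by_contra hlt
  have : n ≤ N := hN (show Nat.card (B.V n) = 0 ∨ Nat.card (B.V n) = 1 by omega)
  omega

/-! ### Cyclic codings and one-vertex diagrams -/

/-- A sequence of compatible cyclic factors `f k : X → ℤ/H k` of a homeomorphism `φ`,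
with residues represented by natural numbers, that separates the points of `X`. -/
structure CyclicCoding {X : Type*} [TopologicalSpace X] (φ : X ≃ₜ X) where
  H : ℕ → ℕ
  f : ℕ → X → ℕ
  H_zero : H 0 = 1
  H_dvd : ∀ k, H k ∣ H (k + 1)
  f_lt : ∀ k x, f k x < H k
  f_map : ∀ k x, f k (φ x) ≡ f k x + 1 [MOD H k]
  f_succ : ∀ k x, f (k + 1) x ≡ f k x [MOD H k]
  isLocallyConstant : ∀ k, IsLocallyConstant (f k)
  injective : ∀ x y, (∀ k, f k x = f k y) → x = y

/-- The diagram with one vertex at every level and `a n` edges from level `n` to level `n + 1`. -/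
def oneVertex (a : ℕ → ℕ) (ha : ∀ n, 0 < a n) : BratteliDiagram.{0} where
  V _ := Unit
  E n := Fin (a n)
  s _ := ()
  r _ := ()
  finite_V _ := inferInstance
  finite_E _ := inferInstance
  card_V_zero := by simp
  s_surjective n _ := ⟨⟨0, ha n⟩, rfl⟩
  r_surjective n _ := ⟨⟨0, ha n⟩, rfl⟩

/-- The natural ordering of the edges of a diagram with one vertex at every level. -/
def oneVertexOrder (a : ℕ → ℕ) (ha : ∀ n, 0 < a n) : (oneVertex a ha).EdgeOrder where
  lt {n} e f := @LT.lt (Fin (a n)) _ e f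
  range_eq _ := rfl
  irrefl {n} e := lt_irrefl (α := Fin (a n)) e
  trans {n} _ _ _ := lt_trans (α := Fin (a n))
  trichotomous {n} e f _ := lt_trichotomy (α := Fin (a n)) e f

section OneVertex

variable {a : ℕ → ℕ} {ha : ∀ n, 0 < a n} {n : ℕ}

theorem oneVertexOrder_isMaxEdge {e : (oneVertex a ha).E n} :
    (oneVertexOrder a ha).IsMaxEdge e ↔ (show Fin (a n) from e).val + 1 = a n := by
  constructor
  · intro h
    have he := (show Fin (a n) from e).isLt
    by_contra hne
    exact h (⟨(show Fin (a n) from e).val + 1, by omega⟩ : Fin (a n)) (Nat.lt_succ_self _)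
  · intro h f hf
    have hf' : (show Fin (a n) from e).val < (show Fin (a n) from f).val := hf
    have := (show Fin (a n) from f).isLt
    omega

theorem oneVertexOrder_isMinEdge {e : (oneVertex a ha).E n} :
    (oneVertexOrder a ha).IsMinEdge e ↔ (show Fin (a n) from e).val = 0 := by
  constructor
  · intro h
    by_contra hne
    exact h (⟨0, ha n⟩ : Fin (a n)) (Nat.pos_of_ne_zero hne)
  · intro h f hf
    have hf' : (show Fin (a n) from f).val < (show Fin (a n) from e).val := hf
    omega

theorem oneVertexOrder_isSuccEdge {e f : (oneVertex a ha).E n}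
    (h : (show Fin (a n) from f).val = (show Fin (a n) from e).val + 1) :
    (oneVertexOrder a ha).IsSuccEdge e f := by
  refine ⟨show (show Fin (a n) from e).val < (show Fin (a n) from f).val by omega, ?_⟩
  intro g hg hg'
  have h1 : (show Fin (a n) from e).val < (show Fin (a n) from g).val := hg
  have h2 : (show Fin (a n) from g).val < (show Fin (a n) from f).val := hg'
  omega

end OneVertex

/-! ### Mixed radix expansion and addition with carry -/

namespace CyclicCoding

variable {X : Type*} [TopologicalSpace X] {φ : X ≃ₜ X} (c : CyclicCoding φ)

theorem H_pos [Nonempty X] (k : ℕ) : 0 < c.H k :=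
  (Nat.zero_le _).trans_lt (c.f_lt k (Classical.arbitrary X))

/-- The ratio of consecutive periods. -/
def ratio (n : ℕ) : ℕ := c.H (n + 1) / c.H n

theorem H_succ (n : ℕ) : c.H (n + 1) = c.H n * c.ratio n :=
  (Nat.mul_div_cancel' (c.H_dvd n)).symm

theorem ratio_pos [Nonempty X] (n : ℕ) : 0 < c.ratio n :=
  Nat.pos_of_mul_pos_left (c.H_succ n ▸ c.H_pos (n + 1))

/-- The digits of a point in the mixed radix expansion of its codes. -/
def digit (n : ℕ) (x : X) : ℕ := c.f (n + 1) x / c.H n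

theorem digit_lt (n : ℕ) (x : X) : c.digit n x < c.ratio n :=
  Nat.div_lt_of_lt_mul (c.H_succ n ▸ c.f_lt (n + 1) x)

theorem f_zero (x : X) : c.f 0 x = 0 := by
  have := c.f_lt 0 x
  rw [c.H_zero] at this
  omega

theorem f_succ_eq (n : ℕ) (x : X) : c.f (n + 1) x = c.f n x + c.H n * c.digit n x := by
  have h : c.f (n + 1) x % c.H n = c.f n x :=
    Eq.trans (c.f_succ n x) (Nat.mod_eq_of_lt (c.f_lt n x))
  conv_lhs => rw [← Nat.mod_add_div (c.f (n + 1) x) (c.H n), h]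
  rfl

theorem digit_eq [Nonempty X] {n m : ℕ} {x : X} (h : c.f (n + 1) x = c.f n x + c.H n * m) :
    c.digit n x = m := by
  rw [f_succ_eq] at h
  exact Nat.eq_of_mul_eq_mul_left (c.H_pos n) (by omega)

theorem f_eq_of_digit {N : ℕ} {x y : X} (h : ∀ n < N, c.digit n x = c.digit n y) :
    c.f N x = c.f N y := by
  induction N with
  | zero => rw [f_zero, f_zero]
  | succ N ih => rw [f_succ_eq, f_succ_eq, ih fun n hn => h n (by omega), h N N.lt_succ_self]

theorem f_eq_zero_iff [Nonempty X] {N : ℕ} {x : X} :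
    c.f N x = 0 ↔ ∀ n < N, c.digit n x = 0 := by
  induction N with
  | zero => simp [f_zero]
  | succ N ih =>
    have := (c.H_pos N).ne'
    rw [f_succ_eq, Nat.add_eq_zero_iff, ih, mul_eq_zero, Nat.forall_lt_succ_right]
    simp [this]

theorem f_eq_max_iff [Nonempty X] {N : ℕ} {x : X} :
    c.f N x + 1 = c.H N ↔ ∀ n < N, c.digit n x + 1 = c.ratio n := by
  induction N with
  | zero => simp [f_zero, c.H_zero]
  | succ N ih =>
    rw [Nat.forall_lt_succ_right, ← ih, f_succ_eq, H_succ]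
    have h1 := c.f_lt N x
    have h2 := c.digit_lt N x
    constructor
    · intro h
      have h3 : c.digit N x + 1 = c.ratio N := by
        by_contra hne
        have h4 : c.H N * (c.digit N x + 2) ≤ c.H N * c.ratio N :=
          Nat.mul_le_mul_left _ (by omega)
        rw [mul_add] at h4
        omega
      refine ⟨?_, h3⟩
      rw [← h3, mul_add] at h
      omega
    · rintro ⟨h3, h4⟩
      rw [← h4, mul_add]
      omega

theorem f_map_of_lt {N : ℕ} {x : X} (h : c.f N x + 1 ≠ c.H N) : c.f N (φ x) = c.f N x + 1 :=
  (c.f_map N x).eq_of_lt_of_lt (c.f_lt _ _) (by have := c.f_lt N x; omega)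

theorem f_map_eq_zero_iff [Nonempty X] {N : ℕ} {x : X} :
    c.f N (φ x) = 0 ↔ c.f N x + 1 = c.H N := by
  constructor
  · intro h
    by_contra hne
    have := c.f_map_of_lt hne
    omega
  · intro h
    have := c.f_map N x
    rw [h] at this
    exact (this.trans (show c.H N ≡ 0 [MOD c.H N] by simp [Nat.ModEq])).eq_of_lt_of_lt
      (c.f_lt _ _) (c.H_pos N)

/-- Iterating `φ` from any point reaches residue `0`; further steps then reach every residue. -/
theorem exists_f_eq [Nonempty X] {N j : ℕ} (hj : j < c.H N) : ∃ x, c.f N x = j := by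
  induction j with
  | zero =>
    obtain ⟨x₀⟩ := ‹Nonempty X›
    have h : ∀ i : ℕ, c.f N (φ^[i] x₀) ≡ c.f N x₀ + i [MOD c.H N] := by
      intro i
      induction i with
      | zero => rfl
      | succ i ih =>
        rw [Function.iterate_succ_apply', ← add_assoc]
        exact (c.f_map N _).trans (ih.add_right 1)
    refine ⟨φ^[c.H N - c.f N x₀] x₀, ?_⟩
    have h1 := h (c.H N - c.f N x₀)
    rw [Nat.add_sub_cancel' (c.f_lt N x₀).le] at h1
    exact (h1.trans (show c.H N ≡ 0 [MOD c.H N] by simp [Nat.ModEq])).eq_of_lt_of_lt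
      (c.f_lt _ _) hj
  | succ j ih =>
    obtain ⟨x, hx⟩ := ih (by omega)
    exact ⟨φ x, by rw [c.f_map_of_lt (by omega), hx]⟩

/-- The one-vertex diagram given by the ratios of consecutive periods. -/
abbrev diagram [Nonempty X] : BratteliDiagram.{0} := oneVertex c.ratio c.ratio_pos

/-- The expansion of a point, as a path. -/
def expansion [Nonempty X] (x : X) : c.diagram.PathSpace :=
  ⟨fun n => (⟨c.digit n x, c.digit_lt n x⟩ : Fin (c.ratio n)), fun _ => rfl⟩

theorem expansion_apply_eq_iff [Nonempty X] {n : ℕ} {x y : X} :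
    (c.expansion x).1 n = (c.expansion y).1 n ↔ c.digit n x = c.digit n y :=
  Fin.ext_iff

theorem continuous_expansion [Nonempty X] : Continuous c.expansion := by
  refine Continuous.subtype_mk (continuous_pi fun n => ?_) _
  refine IsLocallyConstant.continuous ((IsLocallyConstant.iff_eventually_eq _).2 fun x => ?_)
  filter_upwards [(c.isLocallyConstant (n + 1)).eventually_eq x] with y hy
  exact Fin.ext (by simp only [digit, hy])

theorem expansion_injective [Nonempty X] : Function.Injective c.expansion := fun x y h =>
  c.injective x y fun _ => c.f_eq_of_digit fun _ _ => c.expansion_apply_eq_iff.1 (h ▸ rfl)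

theorem exists_digit_eq [Nonempty X] (y : ∀ n, Fin (c.ratio n)) (N : ℕ) :
    ∃ x, ∀ n < N, c.digit n x = y n := by
  have h : ∃ j < c.H N, ∀ x, c.f N x = j → ∀ n < N, c.digit n x = y n := by
    induction N with
    | zero => exact ⟨0, c.H_pos 0, by simp⟩
    | succ N ih =>
      obtain ⟨j, hj, h⟩ := ih
      refine ⟨j + c.H N * y N, ?_, fun x hx => ?_⟩
      · have h1 : c.H N * (y N + 1) ≤ c.H N * c.ratio N := Nat.mul_le_mul_left _ (y N).isLt
        rw [H_succ]
        rw [mul_add] at h1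
        omega
      · have hfj : c.f N x = j := by
          refine ((c.f_succ N x).symm.trans ?_).eq_of_lt_of_lt (c.f_lt _ _) hj
          rw [hx]
          simp [Nat.ModEq]
        rw [Nat.forall_lt_succ_right]
        exact ⟨h x hfj, c.digit_eq (by rw [hx, hfj])⟩
  obtain ⟨j, hj, h⟩ := h
  obtain ⟨x, hx⟩ := c.exists_f_eq hj
  exact ⟨x, h x hx⟩

/-- The image is compact, hence closed, and it is dense because every finite string of digits
occurs. -/
theorem expansion_surjective [Nonempty X] [CompactSpace X] :
    Function.Surjective c.expansion := by
  intro y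
  have hclosed : IsClosed (Set.range c.expansion) :=
    (isCompact_range c.continuous_expansion).isClosed
  by_contra hy
  obtain ⟨m, hm⟩ := exists_agree_subset hclosed.isOpen_compl (x := y) hy
  obtain ⟨x, hx⟩ := c.exists_digit_eq (fun n => y.1 n) m
  exact hm (c.expansion x) (fun i hi => Fin.ext (hx i hi)) ⟨x, rfl⟩

/-- The expansion, as a homeomorphism. -/
noncomputable def expansionHomeomorph [Nonempty X] [CompactSpace X] :
    X ≃ₜ c.diagram.PathSpace :=
  Continuous.homeoOfEquivCompactToT2
    (f := Equiv.ofBijective c.expansion ⟨c.expansion_injective, c.expansion_surjective⟩)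
    c.continuous_expansion

/-- The transport of `φ` to the path space of the one-vertex diagram. -/
noncomputable def adicMap [Nonempty X] [CompactSpace X] :
    c.diagram.PathSpace ≃ₜ c.diagram.PathSpace :=
  (c.expansionHomeomorph.symm.trans φ).trans c.expansionHomeomorph

theorem adicMap_expansion [Nonempty X] [CompactSpace X] (x : X) :
    c.adicMap (c.expansion x) = c.expansion (φ x) := by
  change c.expansionHomeomorph (φ (c.expansionHomeomorph.symm (c.expansionHomeomorph x))) = _
  rw [Homeomorph.symm_apply_apply]
  rfl

theorem expansion_mem_maxPaths_iff [Nonempty X] {x : X} :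
    c.expansion x ∈ (oneVertexOrder c.ratio c.ratio_pos).maxPaths ↔
      ∀ N, c.f N x + 1 = c.H N := by
  simp only [f_eq_max_iff]
  constructor
  · exact fun h N n _ => oneVertexOrder_isMaxEdge.1 (h n)
  · exact fun h n => oneVertexOrder_isMaxEdge.2 (h (n + 1) n n.lt_succ_self)

theorem expansion_mem_minPaths_iff [Nonempty X] {x : X} :
    c.expansion x ∈ (oneVertexOrder c.ratio c.ratio_pos).minPaths ↔ ∀ N, c.f N x = 0 := by
  simp only [f_eq_zero_iff]
  constructor
  · exact fun h N n _ => oneVertexOrder_isMinEdge.1 (h n)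
  · exact fun h n => oneVertexOrder_isMinEdge.2 (h (n + 1) n n.lt_succ_self)

theorem isVershikMap_adicMap [Nonempty X] [CompactSpace X] :
    (oneVertexOrder c.ratio c.ratio_pos).IsVershikMap c.adicMap where
  image_maxPaths := by
    have h : ∀ x, c.expansion (φ x) ∈ (oneVertexOrder c.ratio c.ratio_pos).minPaths ↔
        c.expansion x ∈ (oneVertexOrder c.ratio c.ratio_pos).maxPaths := fun x => by
      rw [expansion_mem_minPaths_iff, expansion_mem_maxPaths_iff]
      exact forall_congr' fun N => c.f_map_eq_zero_iff
    ext y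
    constructor
    · rintro ⟨z, hz, rfl⟩
      obtain ⟨x, rfl⟩ := c.expansion_surjective z
      rw [adicMap_expansion]
      exact (h x).2 hz
    · intro hy
      obtain ⟨x, rfl⟩ := c.expansion_surjective y
      obtain ⟨x, rfl⟩ := φ.surjective x
      exact ⟨_, (h x).1 hy, c.adicMap_expansion x⟩
  succ := by
    intro y k hmax hk
    obtain ⟨x, rfl⟩ := c.expansion_surjective y
    rw [adicMap_expansion]
    have hmax' : ∀ n < k, c.digit n x + 1 = c.ratio n := fun n hn =>
      oneVertexOrder_isMaxEdge.1 (hmax n hn)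
    have hk' : c.digit k x + 1 ≠ c.ratio k := fun h => hk (oneVertexOrder_isMaxEdge.2 h)
    have hfk : c.f k x + 1 = c.H k := c.f_eq_max_iff.2 hmax'
    have hfφk : c.f k (φ x) = 0 := c.f_map_eq_zero_iff.2 hfk
    -- The carry stops at `k`: a non-maximal digit there prevents all later residues from wrapping
    -- around, while the residue at `k` itself wraps to `0`.
    have hlate : ∀ N, k < N → c.f N (φ x) = c.f N x + 1 := fun N hN =>
      c.f_map_of_lt fun h => hk' (c.f_eq_max_iff.1 h k hN)
    refine ⟨fun i hi => oneVertexOrder_isMinEdge.2 (c.f_eq_zero_iff.1 hfφk i hi),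
      oneVertexOrder_isSuccEdge (c.digit_eq ?_), fun i hi => Fin.ext (c.digit_eq ?_)⟩
    · change c.f (k + 1) (φ x) = c.f k (φ x) + c.H k * (c.digit k x + 1)
      rw [hlate _ k.lt_succ_self, hfφk, f_succ_eq, mul_add]
      omega
    · change c.f (i + 1) (φ x) = c.f i (φ x) + c.H i * c.digit i x
      rw [hlate _ (by omega), hlate _ hi, f_succ_eq]
      omega

end CyclicCoding

/-! ### Transport of minimality and cyclic quotients -/

theorem IsTopConjugate.isMinimalSystem {X Y : Type*} [TopologicalSpace X] [TopologicalSpace Y]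
    {S : X ≃ₜ X} {T : Y ≃ₜ Y} (h : IsTopConjugate S T) (hS : IsMinimalSystem S) :
    IsMinimalSystem T := by
  obtain ⟨h, hh⟩ := h
  have hpow : ∀ (k : ℤ) (x : X), (T ^ k) (h x) = h ((S ^ k) x) := by
    have hinv : ∀ x, T⁻¹ (h x) = h (S⁻¹ x) := fun x => by
      apply T.injective
      rw [← hh, ← Homeomorph.mul_apply, ← Homeomorph.mul_apply, mul_inv_cancel, mul_inv_cancel,
        Homeomorph.one_apply, Homeomorph.one_apply]
    intro k
    induction k with
    | zero => simp
    | succ n ih =>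
      intro x
      rw [zpow_add_one, zpow_add_one, Homeomorph.mul_apply, Homeomorph.mul_apply, ← hh, ih]
    | pred n ih =>
      intro x
      rw [zpow_sub_one, zpow_sub_one, Homeomorph.mul_apply, Homeomorph.mul_apply, hinv, ih]
  intro y
  obtain ⟨x, rfl⟩ := h.surjective y
  have := h.surjective.denseRange.dense_image h.continuous (hS x)
  rw [← Set.range_comp] at this
  simpa only [hpow, Function.comp_def] using this

theorem pow_apply_eq_iterate {X : Type*} [TopologicalSpace X] (φ : X ≃ₜ X) (n : ℕ) (x : X) :
    (φ ^ n) x = φ^[n] x := by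
  induction n generalizing x with
  | zero => rfl
  | succ n ih => rw [pow_succ, Homeomorph.mul_apply, ih, Function.iterate_succ_apply]

/-- If `φ` acts transitively on a finite quotient, then the quotient is a cyclic factor. -/
theorem exists_residue {X : Type*} [TopologicalSpace X] {φ : X ≃ₜ X} (R : Setoid X)
    [Finite (Quotient R)] (hφ : ∀ x y, R x y → R (φ x) (φ y))
    (htrans : ∀ x y, ∃ k : ℤ, R ((φ ^ k) x) y) (x₀ : X) :
    ∃ (H : ℕ) (f : X → ℕ), (∀ x, f x < H) ∧
      ∀ x (n : ℕ), f x ≡ n [MOD H] ↔ R (φ^[n] x₀) x := by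
  let q : X → Quotient R := Quotient.mk R
  have hq : ∀ x y, q x = q y ↔ R x y := fun x y => Quotient.eq
  let g : Quotient R → Quotient R := Quotient.map φ hφ
  have hg : Function.Semiconj q φ g := fun x => rfl
  have hgn : ∀ n x, q (φ^[n] x) = g^[n] (q x) := fun n => hg.iterate_right n
  have hinj : Function.Injective g := Finite.injective_iff_surjective.2 fun b => by
    obtain ⟨y, rfl⟩ := Quotient.exists_rep b
    obtain ⟨x, rfl⟩ := φ.surjective y
    exact ⟨q x, rfl⟩
  have hper : ∀ b, b ∈ Function.periodicPts g := hinj.mem_periodicPts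
  have hforward : ∀ x, ∃ n : ℕ, g^[n] (q x₀) = q x := by
    intro x
    obtain ⟨k, hk⟩ := htrans x₀ x
    rcases Int.eq_nat_or_neg k with ⟨n, rfl | rfl⟩
    · rw [zpow_natCast, pow_apply_eq_iterate] at hk
      exact ⟨n, by rw [← hgn, hq]; exact hk⟩
    · have h1 : g^[n] (q x) = q x₀ := by
        rw [← (hq _ _).2 hk, ← hgn, ← pow_apply_eq_iterate, ← zpow_natCast,
          ← Homeomorph.mul_apply, ← zpow_add]
        simp
      obtain ⟨p, hp, hpx⟩ := Function.mem_periodicPts.1 (hper (q x))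
      -- With period `p`, going back `n` steps equals going forward `n * p - n` steps.
      refine ⟨n * p - n, ?_⟩
      rw [← h1, ← Function.iterate_add_apply,
        Nat.sub_add_cancel (Nat.le_mul_of_pos_right n hp)]
      exact hpx.const_mul n
  choose N hN using hforward
  refine ⟨Function.minimalPeriod g (q x₀), fun x => N x % Function.minimalPeriod g (q x₀),
    fun x => Nat.mod_lt _ (Function.minimalPeriod_pos_of_mem_periodicPts (hper _)),
    fun x n => ?_⟩
  have hpos := Function.minimalPeriod_pos_of_mem_periodicPts (hper (q x₀))
  rw [← hq, hgn, ← hN x, ← Function.iterate_mod_minimalPeriod_eq (n := n),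
    ← Function.iterate_mod_minimalPeriod_eq (n := N x),
    Function.iterate_eq_iterate_iff_of_lt_minimalPeriod (Nat.mod_lt _ hpos) (Nat.mod_lt _ hpos),
    Nat.ModEq, Nat.mod_mod, eq_comm]

section

variable {B : BratteliDiagram.{u}}

/-- The equivalence relation of having the same first `m` edges. -/
def agreeSetoid (B : BratteliDiagram.{u}) (m : ℕ) : Setoid B.PathSpace where
  r := Agree m
  iseqv := ⟨fun _ _ _ => rfl, Agree.symm, Agree.trans⟩

instance (m : ℕ) : Finite (Quotient (B.agreeSetoid m)) := by
  refine Finite.of_injective (β := ∀ i : Fin m, B.E i)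
    (Quotient.lift (fun x i => x.1 i) fun x y h => funext fun i => h i i.2) ?_
  intro a b
  induction a, b using Quotient.inductionOn₂ with
  | _ x y => exact fun h => Quotient.sound fun i hi => congrFun h ⟨i, hi⟩

/-- Each residue is the time at which the orbit of `x₀` visits the cylinder, so every compatibility
can be tested along that one orbit. -/
theorem exists_cyclicCoding {φ : B.PathSpace ≃ₜ B.PathSpace} {m : ℕ → ℕ} (hm : StrictMono m)
    (hm0 : m 0 = 0) (hφ : ∀ k x y, Agree (m k) x y → Agree (m k) (φ x) (φ y))
    (htrans : ∀ n x y, ∃ k : ℤ, Agree n ((φ ^ k) x) y) : Nonempty (CyclicCoding φ) := by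
  obtain ⟨x₀⟩ := (inferInstance : Nonempty B.PathSpace)
  choose H f hlt hf using fun k =>
    exists_residue (B.agreeSetoid (m k)) (hφ k) (htrans (m k)) x₀
  have hf' : ∀ k x n, f k x ≡ n [MOD H k] ↔ Agree (m k) (φ^[n] x₀) x := hf
  have hmono : ∀ k {x y : B.PathSpace}, Agree (m (k + 1)) x y → Agree (m k) x y := fun k _ _ h =>
    h.mono (hm k.lt_succ_self).le
  have hzero : ∀ k, f k x₀ ≡ 0 [MOD H k] := fun k => (hf' k x₀ 0).2 fun _ _ => rfl
  have heq : ∀ k x y, Agree (m k) x y ↔ f k x = f k y := by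
    intro k x y
    have hx := (hf' k x _).1 rfl
    constructor
    · intro h
      exact ((hf' k y _).2 (hx.trans h)).symm.eq_of_lt_of_lt (hlt k x) (hlt k y)
    · intro h
      exact hx.symm.trans (h ▸ (hf' k y _).1 rfl)
  refine ⟨⟨H, f, ?_, fun k => ?_, hlt, fun k x => ?_, fun k x => ?_, fun k => ?_, ?_⟩⟩
  -- At length `0` all paths agree, so `x₀` has residues `0` and `1` at once.
  · have h : f 0 x₀ ≡ 1 [MOD H 0] := (hf' 0 x₀ 1).2 fun i hi => by omega
    exact Nat.dvd_one.1 ((Nat.modEq_zero_iff_dvd).1 (h.symm.trans (hzero 0)))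
  -- A return of `x₀` to its longer cylinder is also a return to the shorter one.
  · have h : f (k + 1) x₀ ≡ H (k + 1) [MOD H (k + 1)] :=
      (hzero _).trans (Nat.modEq_zero_iff_dvd.2 dvd_rfl).symm
    have h' := (hf' k x₀ _).2 (hmono k ((hf' _ _ _).1 h))
    exact Nat.modEq_zero_iff_dvd.1 (h'.symm.trans (hzero k))
  · rw [hf', Function.iterate_succ_apply']
    exact hφ k _ _ ((hf' k x _).1 rfl)
  · exact ((hf' k x _).2 (hmono k ((hf' (k + 1) x _).1 rfl))).symm
  · refine (IsLocallyConstant.iff_eventually_eq _).2 fun x => ?_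
    filter_upwards [(isOpen_agree (m k) x).mem_nhds fun _ _ => rfl] with y hy
    exact (heq k y x).1 hy
  · intro x y h
    refine Subtype.ext (funext fun i => ?_)
    exact (heq (i + 1) x y).2 (h _) i (hm.le_apply (x := i + 1))

end

end BratteliDiagram

/-! ### The odometer -/

theorem mainTheorem11 (B : BratteliDiagram.{u}) (d : ℕ) (hd : 2 ≤ d)
    (hsimple : B.IsSimple) (hrank : B.HasRank d)
    (ω : B.EdgeOrder) (hperfect : ω.IsPerfect) (hmax : ω.maxPaths.ncard = d) :
    ∀ φ : B.PathSpace ≃ₜ B.PathSpace, ω.IsVershikMap φ →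
      ∃ (Y : Type) (_ : TopologicalSpace Y) (T : Y ≃ₜ Y),
        BratteliDiagram.IsOdometer T ∧ BratteliDiagram.IsTopConjugate φ T := by
  intro φ hφ
  have hmin : ω.minPaths.ncard = d := by
    rw [← hφ.image_maxPaths, Set.ncard_image_of_injective _ φ.injective, hmax]
  obtain ⟨N, hN⟩ := hφ.exists_forall_agree (Set.finite_of_ncard_pos (by omega))
  -- Enumerating all lengths whose cylinders are respected by `φ`, not just the levels with `d`
  -- vertices, includes length `0`, where the coding must start.
  let p : ℕ → Prop := fun m => ∀ x y, BratteliDiagram.Agree m x y →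
    BratteliDiagram.Agree m (φ x) (φ y)
  have hp : {m | p m}.Infinite := by
    refine (hrank.2.1.sdiff (Set.finite_Iio N)).mono fun m hm => ?_
    exact hN m (not_lt.1 hm.2) (by rw [hmin]; exact hm.1)
  have hp0 : p 0 := fun x y _ i hi => absurd hi i.not_lt_zero
  obtain ⟨c⟩ := BratteliDiagram.exists_cyclicCoding (φ := φ) (m := Nat.nth p)
    (Nat.nth_strictMono hp)
    (Nat.nth_zero_of_zero hp0) (fun k => Nat.nth_mem_of_infinite hp k)
    (hφ.exists_zpow_agree hsimple)
  obtain ⟨N₀, hN₀⟩ := hrank.two_le_card hd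
  have hperf := BratteliDiagram.perfectSpace_pathSpace hsimple hN₀
  have hconj : BratteliDiagram.IsTopConjugate φ c.adicMap :=
    ⟨c.expansionHomeomorph, fun x => (c.adicMap_expansion x).symm⟩
  refine ⟨c.diagram.PathSpace, inferInstance, c.adicMap, ⟨⟨inferInstance, inferInstance,
    inferInstance, inferInstance, ?_⟩, hconj.isMinimalSystem (hφ.isMinimalSystem hsimple), ?_⟩,
    hconj⟩
  · refine perfectSpace_iff_forall_not_isolated.2 fun y => ?_
    obtain ⟨x, rfl⟩ := c.expansionHomeomorph.surjective y
    rw [← c.expansionHomeomorph.map_punctured_nhds_eq x]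
    exact (perfectSpace_iff_forall_not_isolated.1 hperf x).map _
  · exact ⟨c.diagram, _, c.adicMap, fun _ => Nat.card_unique (α := Unit), c.isVershikMap_adicMap,
      Homeomorph.refl _, fun _ => rfl⟩
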